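/- Let $\mathbb S$ be a semiring (for instance $\mathbb S=\mathbb C$). Let $\mathbf{Mat}_\oplus$ be the strict symmetric monoidal category whose objects are the natural numbers, whose morphisms $m\to n$ are the $m\times n$ matrices over $\mathbb S$, composed by matrix multiplication (the composite of $A:m\to n$ followed by $B:n\to k$, written $A;B$, is $AB$), with tensor product $m\oplus n=m+n$ on objects and the block-diagonal sum on morphisms, and with the block-exchange matrices as symmetries. Let $\mathbf{Path}$ be the PROP (strict symmetric monoidal category with objects the natural numbers and tensor product $m\otimes n=m+n$) generated by morphisms $\delta:1\to 2$, $\epsilon:1\to 0$, $\mu:2\to 1$, $\eta:0\to 1$ and $r:1\to 1$ for each $r\in\mathbb S$, subject to the following equations (where $f;g$ means $f$ followed by $g$, and $\sigma:2\to2$ is the symmetry): 1. $(\mu,\eta)$ is a commutative monoid and $(\delta,\epsilon)$ is a cocommutative comonoid; 2. bialgebra laws: $\mu;\delta=(\delta\otimes\delta);(\mathrm{id}_1\otimes\sigma\otimes\mathrm{id}_1);(\mu\otimes\mu)$, $\ \mu;\epsilon=\epsilon\otimes\epsilon$, $\ \eta;\delta=\eta\otimes\eta$, $\ \eta;\epsilon=\mathrm{id}_0$;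 3. each $r\in\mathbb S$ is a bialgebra endomorphism: $r;\delta=\delta;(r\otimes r)$, $\ r;\epsilon=\epsilon$, $\ \mu;r=(r\otimes r);\mu$, $\ \eta;r=\eta$; 4. semiring structure: for all $r,s\in\mathbb S$, the composite $r;s$ equals the generator $rs$, the generator $1\in\mathbb S$ equals $\mathrm{id}_1$, the composite $\delta;(r\otimes s);\mu$ equals the generator $r+s$, and the generator $0\in\mathbb S$ equals $\epsilon;\eta$. Let $\mathcal C:\mathbf{Path}\to\mathbf{Mat}_\oplus$ be the symmetric monoidal functor which is the identity on objects and satisfies $\mathcal C(\delta)=\begin{pmatrix}1&1\end{pmatrix}$, $\mathcal C(\mu)=\begin{pmatrix}1\\1\end{pmatrix}$, $\mathcal C(r)=(r)$, while $\mathcal C(\epsilon)$ and $\mathcal C(\eta)$ are the unique $1\times0$ and $0\times1$ matrices. Then the axioms of $\mathbf{Path}$ are complete for $\mathbf{Mat}_\oplus$: two diagrams $f,g:m\to n$ built from the generators, identities and symmetries by composition and tensor product are equal in $\mathbf{Path}$ if and only if $\mathcal C(f)=\mathcal C(g)$. Moreover $\mathcal C$ is a monoidal equivalence: there are a (symmetric)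 monoidal functor $G:\mathbf{Mat}_\oplus\to\mathbf{Path}$ and monoidal natural isomorphisms $\mathrm{Id}_{\mathbf{Path}}\cong G\circ\mathcal C$ and $\mathcal C\circ G\cong \mathrm{Id}_{\mathbf{Mat}_\oplus}$. -/

import Mathlib

open CategoryTheory

universe u

namespace PathCalculus

/-! ## The category of matrices with direct sum -/

section Matrices

variable {S : Type u} [Semiring S]

/-- The direct sum (block-diagonal matrix) `A ⊕ B` of two matrices. -/
def directSum {m n p q : ℕ} (A : Matrix (Fin m) (Fin n) S) (B : Matrix (Fin p) (Fin q) S) :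
    Matrix (Fin (m + p)) (Fin (n + q)) S :=
  Matrix.reindex finSumFinEquiv finSumFinEquiv (Matrix.fromBlocks A 0 0 B)

variable (S) in
/-- The `0`-`1` matrix of a bijection. -/
def permMatrix {m n : ℕ} (e : Fin m ≃ Fin n) : Matrix (Fin m) (Fin n) S :=
  fun i j => if e i = j then 1 else 0

variable (S) in
/-- The block matrix `(0, 1; 1, 0)` which exchanges the summands `m` and `n`. -/
def swapMatrix (m n : ℕ) : Matrix (Fin (m + n)) (Fin (n + m)) S :=
  permMatrix S finAddFlip

theorem directSum_apply {m n p q : ℕ} (A : Matrix (Fin m) (Fin n) S)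
    (B : Matrix (Fin p) (Fin q) S) (i : Fin (m + p)) (j : Fin (n + q)) :
    directSum A B i j =
      if hi : i.1 < m then (if hj : j.1 < n then A ⟨i, hi⟩ ⟨j, hj⟩ else 0)
      else (if hj : j.1 < n then 0 else
        B ⟨i - m, by have := i.2; omega⟩ ⟨j - n, by have := j.2; omega⟩) := by
  induction i using Fin.addCases <;> induction j using Fin.addCases <;> simp [directSum]

theorem directSum_one (m n : ℕ) :
    directSum (1 : Matrix (Fin m) (Fin m) S) (1 : Matrix (Fin n) (Fin n) S) = 1 := by
  simp [directSum, Matrix.fromBlocks_one]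

theorem directSum_mul {m n k p q l : ℕ} (A : Matrix (Fin m) (Fin n) S)
    (A' : Matrix (Fin n) (Fin k) S) (B : Matrix (Fin p) (Fin q) S)
    (B' : Matrix (Fin q) (Fin l) S) :
    directSum A B * directSum A' B' = directSum (A * A') (B * B') := by
  simp [directSum, Matrix.submatrix_mul_equiv, Matrix.fromBlocks_multiply]

theorem permMatrix_mul {m n k : ℕ} (e : Fin m ≃ Fin n) (A : Matrix (Fin n) (Fin k) S) :
    permMatrix S e * A = A.submatrix e id := by
  ext i j
  simp [permMatrix, Matrix.mul_apply]

theorem mul_permMatrix {m n k : ℕ} (e : Fin m ≃ Fin n) (A : Matrix (Fin k) (Fin m) S) :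
    A * permMatrix S e = A.submatrix id e.symm := by
  ext i j
  simp [permMatrix, Matrix.mul_apply, ← Equiv.eq_symm_apply]

theorem permMatrix_refl (m : ℕ) : permMatrix S (Equiv.refl (Fin m)) = 1 := by
  ext i j
  by_cases h : i = j
  · subst h
    simp [permMatrix]
  · simp [permMatrix, h]

theorem permMatrix_trans {m n k : ℕ} (e : Fin m ≃ Fin n) (f : Fin n ≃ Fin k) :
    permMatrix S e * permMatrix S f = permMatrix S (e.trans f) := by
  rw [permMatrix_mul]
  rfl

theorem finAddFlip_val {m n : ℕ} (i : Fin (m + n)) :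
    (finAddFlip i : Fin (n + m)).1 = if i.1 < m then n + i.1 else i.1 - m := by
  induction i using Fin.addCases <;> simp

theorem swapMatrix_apply {m n : ℕ} (i : Fin (m + n)) (j : Fin (n + m)) :
    swapMatrix S m n i j = if (if i.1 < m then n + i.1 else i.1 - m) = j.1 then 1 else 0 := by
  simp [swapMatrix, permMatrix, Fin.ext_iff, finAddFlip_val]

theorem swapMatrix_mul_swapMatrix (m n : ℕ) : swapMatrix S m n * swapMatrix S n m = 1 := by
  rw [swapMatrix, swapMatrix, permMatrix_trans, ← permMatrix_refl]
  congr 1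
  ext i
  induction i using Fin.addCases <;> simp

theorem swapMatrix_natural {m n p q : ℕ} (A : Matrix (Fin m) (Fin n) S)
    (B : Matrix (Fin p) (Fin q) S) :
    directSum A B * swapMatrix S n q = swapMatrix S m p * directSum B A := by
  rw [swapMatrix, swapMatrix, mul_permMatrix, permMatrix_mul]
  have h : (finAddFlip : Fin (n + q) ≃ Fin (q + n)).symm = finAddFlip := rfl
  ext i j
  induction i using Fin.addCases <;> induction j using Fin.addCases <;> simp [directSum, h]

theorem directSum_assoc {m n p q k l : ℕ} (A : Matrix (Fin m) (Fin n) S)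
    (B : Matrix (Fin p) (Fin q) S) (C : Matrix (Fin k) (Fin l) S) :
    directSum (directSum A B) C * permMatrix S (finCongr (Nat.add_assoc n q l)) =
      permMatrix S (finCongr (Nat.add_assoc m p k)) * directSum A (directSum B C) := by
  rw [mul_permMatrix, permMatrix_mul]
  ext i j
  simp only [Matrix.submatrix_apply, directSum_apply, finCongr_symm, finCongr_apply, id,
    Fin.val_cast]
  have := i.2
  have := j.2
  split_ifs <;> first | rfl | omega | (congr 2 <;> omega)

theorem zero_directSum {m n : ℕ} (A : Matrix (Fin m) (Fin n) S) :
    directSum (1 : Matrix (Fin 0) (Fin 0) S) A * permMatrix S (finCongr (Nat.zero_add n)) =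
      permMatrix S (finCongr (Nat.zero_add m)) * A := by
  rw [mul_permMatrix, permMatrix_mul]
  ext i j
  simp [directSum_apply]
  rfl

theorem directSum_zero {m n : ℕ} (A : Matrix (Fin m) (Fin n) S) :
    directSum A (1 : Matrix (Fin 0) (Fin 0) S) * permMatrix S (finCongr (Nat.add_zero n)) =
      permMatrix S (finCongr (Nat.add_zero m)) * A := by
  rw [mul_permMatrix, permMatrix_mul]
  ext i j
  simp [directSum_apply]

theorem directSum_perm_one {m n : ℕ} (h : m = n) (k : ℕ) :
    directSum (permMatrix S (finCongr h)) (1 : Matrix (Fin k) (Fin k) S) =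
      permMatrix S (finCongr (congrArg (· + k) h)) := by
  subst h
  simp [permMatrix_refl, directSum_one]

theorem directSum_one_perm {m n : ℕ} (h : m = n) (k : ℕ) :
    directSum (1 : Matrix (Fin k) (Fin k) S) (permMatrix S (finCongr h)) =
      permMatrix S (finCongr (congrArg (k + ·) h)) := by
  subst h
  simp [permMatrix_refl, directSum_one]

theorem permMatrix_finCongr_trans {m n k : ℕ} (h : m = n) (h' : n = k) :
    permMatrix S (finCongr h) * permMatrix S (finCongr h') =
      permMatrix S (finCongr (h.trans h')) := by
  rw [permMatrix_trans]
  rfl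

theorem permMatrix_pentagon (m n k l : ℕ) :
    directSum (permMatrix S (finCongr (Nat.add_assoc m n k))) (1 : Matrix (Fin l) (Fin l) S) *
        (permMatrix S (finCongr (Nat.add_assoc m (n + k) l)) *
          directSum (1 : Matrix (Fin m) (Fin m) S)
            (permMatrix S (finCongr (Nat.add_assoc n k l)))) =
      permMatrix S (finCongr (Nat.add_assoc (m + n) k l)) *
        permMatrix S (finCongr (Nat.add_assoc m n (k + l))) := by
  rw [directSum_perm_one, directSum_one_perm]
  simp only [permMatrix_finCongr_trans]

theorem permMatrix_triangle (m n : ℕ) :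
    permMatrix S (finCongr (Nat.add_assoc m 0 n)) *
        directSum (1 : Matrix (Fin m) (Fin m) S) (permMatrix S (finCongr (Nat.zero_add n))) =
      directSum (permMatrix S (finCongr (Nat.add_zero m))) (1 : Matrix (Fin n) (Fin n) S) := by
  rw [directSum_perm_one, directSum_one_perm, permMatrix_finCongr_trans]

theorem directSum_swap_one (m n k : ℕ) :
    directSum (swapMatrix S m n) (1 : Matrix (Fin k) (Fin k) S) =
      permMatrix S ((finSumFinEquiv.symm.trans
        (Equiv.sumCongr finAddFlip (Equiv.refl _))).trans finSumFinEquiv) := by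
  ext i j
  induction i using Fin.addCases <;> induction j using Fin.addCases <;>
    simp [directSum, permMatrix, swapMatrix, Matrix.one_apply, Fin.ext_iff]
  all_goals omega

theorem directSum_one_swap (m n k : ℕ) :
    directSum (1 : Matrix (Fin k) (Fin k) S) (swapMatrix S m n) =
      permMatrix S ((finSumFinEquiv.symm.trans
        (Equiv.sumCongr (Equiv.refl _) finAddFlip)).trans finSumFinEquiv) := by
  ext i j
  induction i using Fin.addCases <;> induction j using Fin.addCases <;>
    simp [directSum, permMatrix, swapMatrix, Matrix.one_apply, Fin.ext_iff]
  all_goals omega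

theorem sumPerm_left_val {m n k : ℕ} (i : Fin (m + n + k)) :
    (((finSumFinEquiv.symm.trans (Equiv.sumCongr finAddFlip (Equiv.refl _))).trans
        finSumFinEquiv) i : Fin (n + m + k)).1 =
      if i.1 < m then n + i.1 else if i.1 < m + n then i.1 - m else i.1 := by
  induction i using Fin.addCases with
  | left i =>
    induction i using Fin.addCases <;> simp
  | right i =>
    have h : ¬ m + n + i.1 < m := by omega
    simp [h]
    omega

theorem sumPerm_right_val {m n k : ℕ} (i : Fin (k + (m + n))) :
    (((finSumFinEquiv.symm.trans (Equiv.sumCongr (Equiv.refl _) finAddFlip)).trans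
        finSumFinEquiv) i : Fin (k + (n + m))).1 =
      if i.1 < k then i.1 else if i.1 < k + m then i.1 + n else i.1 - m := by
  induction i using Fin.addCases with
  | left i => simp
  | right i =>
    induction i using Fin.addCases <;> simp <;> omega

theorem swapMatrix_hexagon (m n k : ℕ) :
    permMatrix S (finCongr (Nat.add_assoc m n k)) *
        (swapMatrix S m (n + k) * permMatrix S (finCongr (Nat.add_assoc n k m))) =
      directSum (swapMatrix S m n) (1 : Matrix (Fin k) (Fin k) S) *
        (permMatrix S (finCongr (Nat.add_assoc n m k)) * directSum (1 : Matrix (Fin n) (Fin n) S) (swapMatrix S m k)) := by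
  rw [directSum_swap_one, directSum_one_swap, swapMatrix]
  simp only [permMatrix_trans]
  congr 1
  ext i
  have := i.2
  rw [Equiv.trans_apply, Equiv.trans_apply, Equiv.trans_apply, Equiv.trans_apply]
  simp only [sumPerm_left_val, sumPerm_right_val, finAddFlip_val, finCongr_apply, Fin.val_cast]
  split_ifs <;> omega

theorem swapMatrix_hexagon_reverse (m n k : ℕ) :
    permMatrix S (finCongr (Nat.add_assoc m n k).symm) *
        (swapMatrix S (m + n) k * permMatrix S (finCongr (Nat.add_assoc k m n).symm)) =
      directSum (1 : Matrix (Fin m) (Fin m) S) (swapMatrix S n k) *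
        (permMatrix S (finCongr (Nat.add_assoc m k n).symm) *
          directSum (swapMatrix S m k) (1 : Matrix (Fin n) (Fin n) S)) := by
  rw [directSum_swap_one, directSum_one_swap, swapMatrix]
  simp only [permMatrix_trans]
  congr 1
  ext i
  have := i.2
  rw [Equiv.trans_apply, Equiv.trans_apply, Equiv.trans_apply, Equiv.trans_apply]
  simp only [sumPerm_left_val, sumPerm_right_val, finAddFlip_val, finCongr_apply, Fin.val_cast]
  split_ifs <;> omega

end Matrices

variable (S : Type u)

/-- The category `Mat_⊕` over `S`: its objects are the natural numbers. -/
structure MatCat (S : Type u) where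
  /-- the underlying natural number -/
  dim : ℕ

section MatCategory

variable [Semiring S]

variable {S} in
/-- Morphisms `m ⟶ n` in `Mat_⊕` are the `m × n` matrices over `S`. -/
@[ext]
structure MatCat.Hom (X Y : MatCat S) : Type u where
  /-- the underlying matrix -/
  mat : Matrix (Fin X.dim) (Fin Y.dim) S

/-- The composite of `A` followed by `B` is the matrix product `A * B`. -/
instance : Category.{u} (MatCat S) where
  Hom := MatCat.Hom
  id _ := ⟨1⟩
  comp A B := ⟨A.mat * B.mat⟩
  id_comp A := MatCat.Hom.ext (Matrix.one_mul A.mat)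
  comp_id A := MatCat.Hom.ext (Matrix.mul_one A.mat)
  assoc A B C := MatCat.Hom.ext (Matrix.mul_assoc A.mat B.mat C.mat)

variable {S} in
/-- The isomorphism given by a bijection of index sets. -/
def MatCat.permIso {X Y : MatCat S} (e : Fin X.dim ≃ Fin Y.dim) : X ≅ Y where
  hom := ⟨permMatrix S e⟩
  inv := ⟨permMatrix S e.symm⟩
  hom_inv_id := MatCat.Hom.ext <| by
    refine (permMatrix_trans e e.symm).trans ?_
    rw [Equiv.self_trans_symm]
    exact permMatrix_refl _
  inv_hom_id := MatCat.Hom.ext <| by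
    refine (permMatrix_trans e.symm e).trans ?_
    rw [Equiv.symm_trans_self]
    exact permMatrix_refl _

/-- The tensor product is addition of natural numbers on objects and the direct sum of matrices
on morphisms; the associator and the unitors are identity matrices. -/
instance : MonoidalCategoryStruct (MatCat S) where
  tensorObj X Y := ⟨X.dim + Y.dim⟩
  tensorUnit := ⟨0⟩
  tensorHom A B := ⟨directSum A.mat B.mat⟩
  whiskerLeft X _ _ A := ⟨directSum (1 : Matrix (Fin X.dim) (Fin X.dim) S) A.mat⟩
  whiskerRight A X := ⟨directSum A.mat (1 : Matrix (Fin X.dim) (Fin X.dim) S)⟩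
  associator X Y Z := MatCat.permIso (finCongr (Nat.add_assoc X.dim Y.dim Z.dim))
  leftUnitor X := MatCat.permIso (finCongr (Nat.zero_add X.dim))
  rightUnitor X := MatCat.permIso (finCongr (Nat.add_zero X.dim))

instance : MonoidalCategory (MatCat S) :=
  MonoidalCategory.ofTensorHom
    (id_tensorHom_id := fun X Y => MatCat.Hom.ext (directSum_one X.dim Y.dim))
    (id_tensorHom := fun _ _ _ _ => rfl)
    (tensorHom_id := fun _ _ => rfl)
    (tensorHom_comp_tensorHom := fun A B A' B' =>
      MatCat.Hom.ext (directSum_mul A.mat A'.mat B.mat B'.mat))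
    (associator_naturality := fun A B C =>
      MatCat.Hom.ext (directSum_assoc A.mat B.mat C.mat))
    (leftUnitor_naturality := fun A => MatCat.Hom.ext (zero_directSum A.mat))
    (rightUnitor_naturality := fun A => MatCat.Hom.ext (directSum_zero A.mat))
    (pentagon := fun W X Y Z => MatCat.Hom.ext (permMatrix_pentagon W.dim X.dim Y.dim Z.dim))
    (triangle := fun X Y => MatCat.Hom.ext (permMatrix_triangle X.dim Y.dim))

/-- The symmetry is the block matrix exchanging the two summands. -/
instance : SymmetricCategory (MatCat S) where
  braiding X Y := MatCat.permIso (X := ⟨X.dim + Y.dim⟩) (Y := ⟨Y.dim + X.dim⟩) finAddFlip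
  braiding_naturality_right X _ _ A :=
    MatCat.Hom.ext (swapMatrix_natural (1 : Matrix (Fin X.dim) (Fin X.dim) S) A.mat)
  braiding_naturality_left A X :=
    MatCat.Hom.ext (swapMatrix_natural A.mat (1 : Matrix (Fin X.dim) (Fin X.dim) S))
  hexagon_forward X Y Z := MatCat.Hom.ext (swapMatrix_hexagon X.dim Y.dim Z.dim)
  hexagon_reverse X Y Z := MatCat.Hom.ext (swapMatrix_hexagon_reverse X.dim Y.dim Z.dim)
  symmetry X Y := MatCat.Hom.ext (swapMatrix_mul_swapMatrix X.dim Y.dim)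

end MatCategory

/-! ## The Path calculus -/

/-- Path diagrams with `m` inputs and `n` outputs: all sequential and parallel compositions of
identity wires, crossings of bundles of wires and the generators. The composite `comp f g` is
`f` followed by `g`. -/
inductive Diagram : ℕ → ℕ → Type u
  /-- `n` parallel wires -/
  | id (n : ℕ) : Diagram n n
  | comp {m n k : ℕ} : Diagram m n → Diagram n k → Diagram m k
  | tensor {m n p q : ℕ} : Diagram m n → Diagram p q → Diagram (m + p) (n + q)
  /-- the crossing of `m` wires with `n` wires; `σ` is `swap 1 1` -/
  | swap (m n : ℕ) : Diagram (m + n) (n + m)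
  /-- the comultiplication `δ` -/
  | delta : Diagram 1 2
  /-- the counit `ε` -/
  | epsilon : Diagram 1 0
  /-- the multiplication `μ` -/
  | mu : Diagram 2 1
  /-- the unit `η` -/
  | eta : Diagram 0 1
  /-- the endomorphism labelled by `r` -/
  | scalar (r : S) : Diagram 1 1

namespace Diagram

variable {S}

/-- `m` parallel wires, seen as a diagram from `m` to `n` when `m = n`. -/
def wires {m n : ℕ} (h : m = n) : Diagram S m n := h ▸ Diagram.id m

variable [Semiring S]

/-- Equality of Path diagrams: the congruence generated by the laws of a PROP (strict symmetric
monoidal category whose objects are the natural numbers, with addition as tensor product),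
the laws of a commutative and cocommutative bialgebra for `(μ, η, δ, ε)`, and the laws of
the scalar endomorphisms. -/
inductive Eqv : {m n : ℕ} → Diagram S m n → Diagram S m n → Prop
  -- congruence
  | refl {m n} (f : Diagram S m n) : Eqv f f
  | symm {m n} {f g : Diagram S m n} : Eqv f g → Eqv g f
  | trans {m n} {f g h : Diagram S m n} : Eqv f g → Eqv g h → Eqv f h
  | comp_congr {m n k} {f f' : Diagram S m n} {g g' : Diagram S n k} :
      Eqv f f' → Eqv g g' → Eqv (comp f g) (comp f' g')
  | tensor_congr {m n p q} {f f' : Diagram S m n} {g g' : Diagram S p q} :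
      Eqv f f' → Eqv g g' → Eqv (tensor f g) (tensor f' g')
  -- category
  | id_comp {m n} (f : Diagram S m n) : Eqv (comp (id m) f) f
  | comp_id {m n} (f : Diagram S m n) : Eqv (comp f (id n)) f
  | assoc {m n k l} (f : Diagram S m n) (g : Diagram S n k) (h : Diagram S k l) :
      Eqv (comp (comp f g) h) (comp f (comp g h))
  -- strict monoidal category
  | tensor_id (m n : ℕ) : Eqv (tensor (id m) (id n)) (id (m + n))
  | tensor_comp {m n k p q l} (f : Diagram S m n) (f' : Diagram S n k) (g : Diagram S p q)
      (g' : Diagram S q l) :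
      Eqv (comp (tensor f g) (tensor f' g')) (tensor (comp f f') (comp g g'))
  | tensor_assoc {m n p q k l} (f : Diagram S m n) (g : Diagram S p q) (h : Diagram S k l) :
      Eqv (comp (tensor (tensor f g) h) (wires (Nat.add_assoc n q l)))
        (comp (wires (Nat.add_assoc m p k)) (tensor f (tensor g h)))
  | zero_tensor {m n} (f : Diagram S m n) :
      Eqv (comp (tensor (id 0) f) (wires (Nat.zero_add n))) (comp (wires (Nat.zero_add m)) f)
  | tensor_zero {m n} (f : Diagram S m n) :
      Eqv (comp (tensor f (id 0)) (wires (Nat.add_zero n))) (comp (wires (Nat.add_zero m)) f)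
  -- symmetry
  | swap_natural {m n p q} (f : Diagram S m n) (g : Diagram S p q) :
      Eqv (comp (tensor f g) (swap n q)) (comp (swap m p) (tensor g f))
  | swap_swap (m n : ℕ) : Eqv (comp (swap m n) (swap n m)) (id (m + n))
  | hexagon (m n k : ℕ) :
      Eqv (comp (wires (Nat.add_assoc m n k))
          (comp (swap m (n + k)) (wires (Nat.add_assoc n k m))))
        (comp (tensor (swap m n) (id k))
          (comp (wires (Nat.add_assoc n m k)) (tensor (id n) (swap m k))))
  | hexagon_reverse (m n k : ℕ) :
      Eqv (comp (wires (Nat.add_assoc m n k).symm)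
          (comp (swap (m + n) k) (wires (Nat.add_assoc k m n).symm)))
        (comp (tensor (id m) (swap n k))
          (comp (wires (Nat.add_assoc m k n).symm) (tensor (swap m k) (id n))))
  -- commutative monoid
  | mu_assoc : Eqv (m := 3) (n := 1) (comp (tensor mu (id 1)) mu) (comp (tensor (id 1) mu) mu)
  | eta_mu : Eqv (m := 1) (n := 1) (comp (tensor eta (id 1)) mu) (id 1)
  | mu_eta : Eqv (m := 1) (n := 1) (comp (tensor (id 1) eta) mu) (id 1)
  | mu_comm : Eqv (m := 2) (n := 1) (comp (swap 1 1) mu) mu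
  -- cocommutative comonoid
  | delta_assoc : Eqv (m := 1) (n := 3) (comp delta (tensor delta (id 1)))
      (comp delta (tensor (id 1) delta))
  | epsilon_delta : Eqv (m := 1) (n := 1) (comp delta (tensor epsilon (id 1))) (id 1)
  | delta_epsilon : Eqv (m := 1) (n := 1) (comp delta (tensor (id 1) epsilon)) (id 1)
  | delta_comm : Eqv (m := 1) (n := 2) (comp delta (swap 1 1)) delta
  -- bialgebra
  | mu_delta : Eqv (m := 2) (n := 2) (comp mu delta)
      (comp (tensor delta delta)
        (comp (n := 4) (tensor (tensor (id 1) (swap 1 1)) (id 1)) (tensor mu mu)))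
  | mu_epsilon : Eqv (m := 2) (n := 0) (comp mu epsilon) (tensor epsilon epsilon)
  | eta_delta : Eqv (m := 0) (n := 2) (comp eta delta) (tensor eta eta)
  | eta_epsilon : Eqv (m := 0) (n := 0) (comp eta epsilon) (id 0)
  -- scalars are bialgebra endomorphisms
  | scalar_delta (r : S) : Eqv (m := 1) (n := 2) (comp (scalar r) delta)
      (comp delta (tensor (scalar r) (scalar r)))
  | scalar_epsilon (r : S) : Eqv (comp (scalar r) epsilon) epsilon
  | mu_scalar (r : S) : Eqv (m := 2) (n := 1) (comp mu (scalar r))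
      (comp (tensor (scalar r) (scalar r)) mu)
  | eta_scalar (r : S) : Eqv (comp eta (scalar r)) eta
  -- semiring structure of the scalars
  | scalar_one : Eqv (scalar 1) (id 1)
  | scalar_mul (r s : S) : Eqv (comp (scalar r) (scalar s)) (scalar (r * s))
  | scalar_zero : Eqv (scalar 0) (comp epsilon eta)
  | scalar_add (r s : S) : Eqv (m := 1) (n := 1)
      (comp delta (comp (tensor (scalar r) (scalar s)) mu)) (scalar (r + s))

/-- The classical interpretation of Path diagrams as matrices. -/
def toMatrix : {m n : ℕ} → Diagram S m n → Matrix (Fin m) (Fin n) S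
  | _, _, id _ => 1
  | _, _, comp f g => toMatrix f * toMatrix g
  | _, _, tensor f g => directSum (toMatrix f) (toMatrix g)
  | _, _, swap m n => swapMatrix S m n
  | _, _, delta => !![1, 1]
  | _, _, epsilon => !![;]
  | _, _, mu => !![1; 1]
  | _, _, eta => !![,]
  | _, _, scalar r => !![r]

theorem toMatrix_wires {m n : ℕ} (h : m = n) :
    (wires h : Diagram S m n).toMatrix = permMatrix S (finCongr h) := by
  subst h
  exact (permMatrix_refl m).symm

/-- Soundness of the rules for the matrix interpretation. -/
theorem Eqv.toMatrix_eq {m n : ℕ} {f g : Diagram S m n} (h : Eqv f g) :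
    f.toMatrix = g.toMatrix := by
  induction h with
  | refl f => rfl
  | symm _ ih => exact ih.symm
  | trans _ _ ih ih' => exact ih.trans ih'
  | comp_congr _ _ ih ih' => simp only [toMatrix, ih, ih']
  | tensor_congr _ _ ih ih' => simp only [toMatrix, ih, ih']
  | id_comp f => simp [toMatrix]
  | comp_id f => simp [toMatrix]
  | assoc f g h => simp [toMatrix, Matrix.mul_assoc]
  | tensor_id m n => exact directSum_one m n
  | tensor_comp f f' g g' => exact directSum_mul _ _ _ _
  | tensor_assoc f g h => simp only [toMatrix, toMatrix_wires]; exact directSum_assoc _ _ _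
  | zero_tensor f => simp only [toMatrix, toMatrix_wires]; exact zero_directSum _
  | tensor_zero f => simp only [toMatrix, toMatrix_wires]; exact directSum_zero _
  | swap_natural f g => exact swapMatrix_natural _ _
  | swap_swap m n => exact swapMatrix_mul_swapMatrix m n
  | hexagon m n k =>
    simp only [toMatrix, toMatrix_wires]; exact swapMatrix_hexagon m n k
  | hexagon_reverse m n k =>
    simp only [toMatrix, toMatrix_wires]; exact swapMatrix_hexagon_reverse m n k
  | eta_epsilon => ext i; exact i.elim0
  | eta_delta => ext i; exact i.elim0
  | eta_scalar => ext i; exact i.elim0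
  | mu_epsilon => ext i j; exact j.elim0
  | scalar_epsilon => ext i j; exact j.elim0
  | _ =>
    ext i j
    fin_cases i <;> fin_cases j <;>
      simp [toMatrix, Matrix.mul_apply, Fin.sum_univ_succ, directSum_apply, swapMatrix_apply,
        Matrix.one_apply]

variable (S) in
/-- Diagrams from `m` to `n`, up to provable equality. -/
def setoid (m n : ℕ) : Setoid (Diagram S m n) where
  r := Eqv
  iseqv := ⟨Eqv.refl, Eqv.symm, Eqv.trans⟩

theorem Eqv.wires_trans {m n k : ℕ} (h : m = n) (h' : n = k) :
    Eqv (comp (wires h) (wires h') : Diagram S m k) (wires (h.trans h')) := by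
  subst h h'
  exact Eqv.id_comp _

theorem Eqv.wires_tensor_id {m n : ℕ} (h : m = n) (k : ℕ) :
    Eqv (tensor (wires h) (id k) : Diagram S (m + k) (n + k)) (wires (congrArg (· + k) h)) := by
  subst h
  exact Eqv.tensor_id _ _

theorem Eqv.id_tensor_wires {m n : ℕ} (h : m = n) (k : ℕ) :
    Eqv (tensor (id k) (wires h) : Diagram S (k + m) (k + n)) (wires (congrArg (k + ·) h)) := by
  subst h
  exact Eqv.tensor_id _ _

end Diagram

/-- The category `Path`, the PROP of Path diagrams: its objects are the natural numbers. -/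
structure PathCat (S : Type u) where
  /-- the underlying natural number -/
  arity : ℕ

section PathCategory

variable [Semiring S]

open Diagram

variable {S} in
/-- Morphisms in `Path` are diagrams modulo the rules. -/
def PathCat.Hom (X Y : PathCat S) : Type u := Quotient (Diagram.setoid S X.arity Y.arity)

variable {S} in
/-- The morphism of `Path` represented by a diagram. -/
def PathCat.ofDiagram {X Y : PathCat S} (f : Diagram S X.arity Y.arity) : PathCat.Hom X Y :=
  Quotient.mk _ f

/-- Composition in `Path` is sequential composition of diagrams. -/
instance : Category.{u} (PathCat S) where
  Hom := PathCat.Hom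
  id X := PathCat.ofDiagram (Diagram.id X.arity)
  comp := Quotient.map₂ Diagram.comp fun _ _ h _ _ h' => Eqv.comp_congr h h'
  id_comp := by rintro X Y ⟨f⟩; exact Quotient.sound (Eqv.id_comp f)
  comp_id := by rintro X Y ⟨f⟩; exact Quotient.sound (Eqv.comp_id f)
  assoc := by rintro W X Y Z ⟨f⟩ ⟨g⟩ ⟨h⟩; exact Quotient.sound (Eqv.assoc f g h)

variable {S} in
/-- The identity morphism between objects with equal arities. -/
def PathCat.wiresIso {X Y : PathCat S} (h : X.arity = Y.arity) : X ≅ Y where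
  hom := PathCat.ofDiagram (wires h)
  inv := PathCat.ofDiagram (wires h.symm)
  hom_inv_id := Quotient.sound (Eqv.wires_trans h h.symm)
  inv_hom_id := Quotient.sound (Eqv.wires_trans h.symm h)

/-- The tensor product is addition on objects and parallel composition of diagrams; the
associator and the unitors are identities. -/
instance : MonoidalCategoryStruct (PathCat S) where
  tensorObj X Y := ⟨X.arity + Y.arity⟩
  tensorUnit := ⟨0⟩
  tensorHom := Quotient.map₂ Diagram.tensor fun _ _ h _ _ h' => Eqv.tensor_congr h h'
  whiskerLeft X _ _ := Quotient.map (Diagram.tensor (Diagram.id X.arity))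
    fun _ _ h => Eqv.tensor_congr (Eqv.refl _) h
  whiskerRight f X := Quotient.map (fun f => Diagram.tensor f (Diagram.id X.arity))
    (fun _ _ h => Eqv.tensor_congr h (Eqv.refl _)) f
  associator X Y Z := PathCat.wiresIso (Nat.add_assoc X.arity Y.arity Z.arity)
  leftUnitor X := PathCat.wiresIso (Nat.zero_add X.arity)
  rightUnitor X := PathCat.wiresIso (Nat.add_zero X.arity)

instance : MonoidalCategory (PathCat S) :=
  MonoidalCategory.ofTensorHom
    (id_tensorHom_id := fun X Y => Quotient.sound (Eqv.tensor_id X.arity Y.arity))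
    (id_tensorHom := by rintro X Y Z ⟨f⟩; rfl)
    (tensorHom_id := by rintro X Y ⟨f⟩ Z; rfl)
    (tensorHom_comp_tensorHom := by
      rintro _ _ _ _ _ _ ⟨f⟩ ⟨g⟩ ⟨f'⟩ ⟨g'⟩
      exact Quotient.sound (Eqv.tensor_comp f f' g g'))
    (associator_naturality := by
      rintro _ _ _ _ _ _ ⟨f⟩ ⟨g⟩ ⟨h⟩
      exact Quotient.sound (Eqv.tensor_assoc f g h))
    (leftUnitor_naturality := by rintro _ _ ⟨f⟩; exact Quotient.sound (Eqv.zero_tensor f))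
    (rightUnitor_naturality := by rintro _ _ ⟨f⟩; exact Quotient.sound (Eqv.tensor_zero f))
    (pentagon := fun W X Y Z => Quotient.sound <|
      (((Eqv.wires_tensor_id _ _).comp_congr
        (((Eqv.refl _).comp_congr (Eqv.id_tensor_wires _ _)).trans
          (Eqv.wires_trans _ _))).trans (Eqv.wires_trans _ _)).trans (Eqv.wires_trans _ _).symm)
    (triangle := fun X Y => Quotient.sound <|
      (((Eqv.refl _).comp_congr (Eqv.id_tensor_wires _ _)).trans (Eqv.wires_trans _ _)).trans
        (Eqv.wires_tensor_id _ _).symm)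

/-- The symmetry is the crossing of wires. -/
instance : SymmetricCategory (PathCat S) where
  braiding X Y :=
    { hom := PathCat.ofDiagram (X := ⟨X.arity + Y.arity⟩) (Y := ⟨Y.arity + X.arity⟩)
        (swap X.arity Y.arity)
      inv := PathCat.ofDiagram (X := ⟨Y.arity + X.arity⟩) (Y := ⟨X.arity + Y.arity⟩)
        (swap Y.arity X.arity)
      hom_inv_id := Quotient.sound (Eqv.swap_swap _ _)
      inv_hom_id := Quotient.sound (Eqv.swap_swap _ _) }
  braiding_naturality_right := by
    rintro X Y Z ⟨f⟩; exact Quotient.sound (Eqv.swap_natural _ f)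
  braiding_naturality_left := by
    rintro X Y ⟨f⟩ Z; exact Quotient.sound (Eqv.swap_natural f _)
  hexagon_forward X Y Z := Quotient.sound (Eqv.hexagon X.arity Y.arity Z.arity)
  hexagon_reverse X Y Z := Quotient.sound (Eqv.hexagon_reverse X.arity Y.arity Z.arity)
  symmetry X Y := Quotient.sound (Eqv.swap_swap X.arity Y.arity)

/-! ## The interpretation functor -/

/-- The functor `C : Path ⥤ Mat_⊕`; it is the identity on objects. -/
def interpretation : PathCat S ⥤ MatCat S where
  obj X := ⟨X.arity⟩
  map := Quotient.lift (fun f => ⟨f.toMatrix⟩) fun _ _ h => MatCat.Hom.ext h.toMatrix_eq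
  map_id _ := rfl
  map_comp := by rintro _ _ _ ⟨f⟩ ⟨g⟩; rfl

/-- `C` is a strict monoidal functor: its structure isomorphisms are identities. -/
def interpretationCoreMonoidal : (interpretation S).CoreMonoidal where
  εIso := Iso.refl _
  μIso X Y := Iso.refl ((interpretation S).obj (MonoidalCategoryStruct.tensorObj X Y))
  μIso_hom_natural_left := by
    rintro X Y ⟨f⟩ Z
    exact (Category.comp_id _).trans (Category.id_comp _).symm
  μIso_hom_natural_right := by
    rintro X Y Z ⟨f⟩
    exact (Category.comp_id _).trans (Category.id_comp _).symm
  associativity X Y Z := by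
    have h : (interpretation S).map (MonoidalCategoryStruct.associator X Y Z).hom =
        (MonoidalCategoryStruct.associator ((interpretation S).obj X)
          ((interpretation S).obj Y) ((interpretation S).obj Z)).hom :=
      MatCat.Hom.ext (toMatrix_wires _)
    rw [h]
    refine (congrArg (· ≫ _) (MonoidalCategory.id_whiskerRight _ _)).trans ?_
    refine Eq.trans ?_ (congrArg (_ ≫ · ≫ _) (MonoidalCategory.whiskerLeft_id _ _).symm)
    exact (Category.id_comp _).trans ((Category.id_comp _).trans
      ((congrArg (_ ≫ ·) (Category.id_comp _)).trans (Category.comp_id _)).symm)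
  left_unitality X := by
    have h : (interpretation S).map (MonoidalCategoryStruct.leftUnitor X).hom =
        (MonoidalCategoryStruct.leftUnitor ((interpretation S).obj X)).hom :=
      MatCat.Hom.ext (toMatrix_wires _)
    rw [h]
    refine Eq.trans ?_ (congrArg (· ≫ _) (MonoidalCategory.id_whiskerRight _ _).symm)
    exact ((Category.id_comp _).trans (Category.id_comp _)).symm
  right_unitality X := by
    have h : (interpretation S).map (MonoidalCategoryStruct.rightUnitor X).hom =
        (MonoidalCategoryStruct.rightUnitor ((interpretation S).obj X)).hom :=
      MatCat.Hom.ext (toMatrix_wires _)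
    rw [h]
    refine Eq.trans ?_ (congrArg (· ≫ _) (MonoidalCategory.whiskerLeft_id _ _).symm)
    exact ((Category.id_comp _).trans (Category.id_comp _)).symm

instance : (interpretation S).Monoidal := (interpretationCoreMonoidal S).toMonoidal

/-- `C` preserves the symmetry. -/
instance : (interpretation S).Braided where
  braided _ _ := (Category.id_comp _).trans (Category.comp_id _).symm

end PathCategory

end PathCalculus

/-! Soundness is `Eqv.toMatrix_eq`; the substance is that a diagram is determined by its matrix. By
Fox's theorem (`CartesianMonoidalCategory.ofNaturalComul`), a symmetric monoidal category in which
every object carries a natural comonoid structure compatible with the tensor product is cartesian.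
In `Path`, copying and discarding `n` wires is such a structure: naturality is proved by induction
on diagrams, and the generator cases are the comonoid, bialgebra and scalar laws (`copyAll_natural`,
`discardAll_natural`). Hence `n` is the `n`-fold power of one wire, and a morphism into it is the
tuple of its components.

The monoid `(μ, η)` makes the morphisms into a single wire a commutative additive monoid on which
the scalars act linearly. Another induction (`ofArity_comp_proj`) writes the `j`-th output of a
diagram as the linear combination of its inputs with coefficients in column `j` of its matrix. Equal
matrices thus give equal components, hence equal diagrams. Conversely, tupling such combinations
realises every matrix. So the interpretation is fully faithful and bijective on objects, and the
inverse of a braided equivalence is braided. -/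

namespace CategoryTheory

/-! ### Fox's theorem: natural comonoids make a tensor product cartesian. -/

open MonoidalCategory Limits

/-- A braided monoidal category with natural counital comultiplications that are compatible with
the tensor product is cartesian monoidal. -/
@[reducible]
def CartesianMonoidalCategory.ofNaturalComul {C : Type*} [Category* C] [MonoidalCategory C]
    [BraidedCategory C] (counit : ∀ X : C, X ⟶ 𝟙_ C) (comul : ∀ X : C, X ⟶ X ⊗ X)
    (counit_natural : ∀ {X Y : C} (f : X ⟶ Y), f ≫ counit Y = counit X)
    (comul_natural : ∀ {X Y : C} (f : X ⟶ Y), f ≫ comul Y = comul X ≫ (f ⊗ₘ f))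
    (counit_unit : counit (𝟙_ C) = 𝟙 _)
    (comul_tensor : ∀ X Y : C, comul (X ⊗ Y) = (comul X ⊗ₘ comul Y) ≫ tensorμ X X Y Y)
    (counit_comul : ∀ X : C, comul X ≫ counit X ▷ X ≫ (λ_ X).hom = 𝟙 X)
    (comul_counit : ∀ X : C, comul X ≫ X ◁ counit X ≫ (ρ_ X).hom = 𝟙 X) :
    CartesianMonoidalCategory C :=
  have hunit : ∀ {X : C} (f : X ⟶ 𝟙_ C), f = counit X := fun {X} f => by
    rw [← counit_natural f, counit_unit, Category.comp_id]
  -- Pairing the two projections gives the identity. This is the uniqueness half of the universal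
  -- property, and the place where `comul_tensor` is needed.
  have hid : ∀ X Y : C, comul (X ⊗ Y) ≫
      ((X ◁ counit Y ≫ (ρ_ X).hom) ⊗ₘ (counit X ▷ Y ≫ (λ_ Y).hom)) = 𝟙 (X ⊗ Y) := fun X Y => by
    have hμ : tensorμ X (𝟙_ C) (𝟙_ C) Y ≫ ((ρ_ X).hom ⊗ₘ (λ_ Y).hom) =
        (ρ_ X).hom ⊗ₘ (λ_ Y).hom := by
      rw [tensorμ, braiding_tensorUnit_left]
      monoidal
    calc _ = (comul X ⊗ₘ comul Y) ≫ tensorμ X X Y Y ≫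
          ((𝟙 X ⊗ₘ counit Y) ⊗ₘ (counit X ⊗ₘ 𝟙 Y)) ≫ ((ρ_ X).hom ⊗ₘ (λ_ Y).hom) := by
          rw [comul_tensor]; simp
      _ = (comul X ⊗ₘ comul Y) ≫ ((𝟙 X ⊗ₘ counit X) ⊗ₘ (counit Y ⊗ₘ 𝟙 Y)) ≫
          ((ρ_ X).hom ⊗ₘ (λ_ Y).hom) := by
          rw [← tensorμ_natural_assoc, hμ]
      _ = (comul X ≫ X ◁ counit X ≫ (ρ_ X).hom) ⊗ₘ (comul Y ≫ counit Y ▷ Y ≫ (λ_ Y).hom) := by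
          simp
      _ = _ := by rw [comul_counit, counit_comul]; simp
  have hfst : ∀ {T X Y : C} (f : T ⟶ X) (g : T ⟶ Y),
      (comul T ≫ (f ⊗ₘ g)) ≫ X ◁ counit Y ≫ (ρ_ X).hom = f := fun {T X Y} f g => by
    -- Discarding the output of `g` amounts to discarding its input, so `g` disappears and the
    -- counit law on `T` remains.
    have h : (comul T ≫ (f ⊗ₘ g)) ≫ X ◁ counit Y ≫ (ρ_ X).hom =
        (comul T ≫ T ◁ counit T ≫ (ρ_ T).hom) ≫ f := by
      rw [← counit_natural g]
      simp [MonoidalCategory.tensorHom_def', ← whisker_exchange_assoc]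
    rw [h, comul_counit, Category.id_comp]
  have hsnd : ∀ {T X Y : C} (f : T ⟶ X) (g : T ⟶ Y),
      (comul T ≫ (f ⊗ₘ g)) ≫ counit X ▷ Y ≫ (λ_ Y).hom = g := fun {T X Y} f g => by
    have h : (comul T ≫ (f ⊗ₘ g)) ≫ counit X ▷ Y ≫ (λ_ Y).hom =
        (comul T ≫ counit T ▷ T ≫ (λ_ T).hom) ≫ g := by
      rw [← counit_natural f, MonoidalCategory.tensorHom_def]
      simp [whisker_exchange_assoc]
    rw [h, counit_comul, Category.id_comp]
  have huniq : ∀ {T X Y : C} (m : T ⟶ X ⊗ Y),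
      m = comul T ≫ ((m ≫ X ◁ counit Y ≫ (ρ_ X).hom) ⊗ₘ (m ≫ counit X ▷ Y ≫ (λ_ Y).hom)) :=
    fun {T X Y} m => by
      rw [← tensorHom_comp_tensorHom, ← reassoc_of% (comul_natural m), hid, Category.comp_id]
  { isTerminalTensorUnit := IsTerminal.ofUniqueHom counit fun _ f => hunit f
    fst X Y := X ◁ counit Y ≫ (ρ_ X).hom
    snd X Y := counit X ▷ Y ≫ (λ_ Y).hom
    fst_def _ _ := rfl
    snd_def _ _ := rfl
    tensorProductIsBinaryProduct X Y := BinaryFan.isLimitMk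
      (fun s => comul s.pt ≫ (s.fst ⊗ₘ s.snd)) (fun s => hfst s.fst s.snd)
      (fun s => hsnd s.fst s.snd) (fun s m h₁ h₂ => by
        rw [← h₁, ← h₂]
        exact huniq m) }

/-! ### Coherence identities for the inductions on the number of wires. -/

section Coherence

open BraidedCategory

variable {C : Type*} [Category* C] [MonoidalCategory C]

theorem tensorHom_leftUnitor_assoc {X Y Z : C} (f : X ⟶ 𝟙_ C) (g : Y ⟶ 𝟙_ C) (h : Z ⟶ 𝟙_ C) :
    (α_ X Y Z).hom ≫ (f ⊗ₘ (g ⊗ₘ h) ≫ (λ_ (𝟙_ C)).hom) ≫ (λ_ (𝟙_ C)).hom =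
      ((f ⊗ₘ g) ≫ (λ_ (𝟙_ C)).hom ⊗ₘ h) ≫ (λ_ (𝟙_ C)).hom := by
  monoidal

theorem tensorHom_tensorμ_assoc [BraidedCategory C] {X Y Z : C} (f : X ⟶ X ⊗ X) (g : Y ⟶ Y ⊗ Y)
    (h : Z ⟶ Z ⊗ Z) :
    (((f ⊗ₘ g) ≫ tensorμ X X Y Y ⊗ₘ h) ≫ tensorμ (X ⊗ Y) (X ⊗ Y) Z Z) ≫
        ((α_ X Y Z).hom ⊗ₘ (α_ X Y Z).hom) =
      (α_ X Y Z).hom ≫ (f ⊗ₘ (g ⊗ₘ h) ≫ tensorμ Y Y Z Z) ≫ tensorμ X X (Y ⊗ Z) (Y ⊗ Z) := by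
  rw [← Category.comp_id h, ← tensorHom_comp_tensorHom, tensorHom_id, Category.assoc,
    Category.assoc, tensor_associativity, associator_naturality_assoc,
    ← Category.comp_id f, ← tensorHom_comp_tensorHom, id_tensorHom,
    Category.assoc, Category.comp_id, Category.comp_id]

theorem tensorHom_leftUnitor_braiding [BraidedCategory C] {X Y : C} (f : X ⟶ 𝟙_ C) (g : Y ⟶ 𝟙_ C) :
    (β_ X Y).hom ≫ (g ⊗ₘ f) ≫ (λ_ (𝟙_ C)).hom = (f ⊗ₘ g) ≫ (λ_ (𝟙_ C)).hom := by
  rw [← braiding_naturality_assoc]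
  simp [← unitors_equal]

/-- On the right `W` and `Z` cross twice, on the left not at all; the symmetry cancels the double
crossing. This gives naturality of copying with respect to crossings. -/
theorem tensorμ_braiding [SymmetricCategory C] (W X Y Z : C) :
    tensorμ W X Y Z ≫ ((β_ W Y).hom ⊗ₘ (β_ X Z).hom) =
      (β_ (W ⊗ X) (Y ⊗ Z)).hom ≫ tensorμ Y Z W X := by
  simp only [tensorμ, Category.assoc, BraidedCategory.braiding_tensor_right_hom,
    BraidedCategory.braiding_tensor_left_hom, comp_whiskerRight, whisker_assoc,
    MonoidalCategory.whiskerLeft_comp, pentagon_assoc, pentagon_inv_hom_hom_hom_inv_assoc,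
    Iso.inv_hom_id_assoc, whiskerLeft_hom_inv_assoc]
  slice_rhs 11 12 =>
    rw [← MonoidalCategory.whiskerLeft_comp, ← comp_whiskerRight, SymmetricCategory.symmetry]
  rw [MonoidalCategory.tensorHom_def]
  monoidal

theorem comul_tensor_counit_left [BraidedCategory C] {X Y : C} (f : X ⟶ X ⊗ X) (g : Y ⟶ Y ⊗ Y)
    (a : X ⟶ 𝟙_ C) (b : Y ⟶ 𝟙_ C) :
    ((f ⊗ₘ g) ≫ tensorμ X X Y Y) ≫ ((a ⊗ₘ b) ≫ (λ_ (𝟙_ C)).hom) ▷ (X ⊗ Y) ≫ (λ_ (X ⊗ Y)).hom =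
      (f ≫ a ▷ X ≫ (λ_ X).hom) ⊗ₘ (g ≫ b ▷ Y ≫ (λ_ Y).hom) := by
  have h := tensorμ_natural_assoc a (𝟙 X) b (𝟙 Y)
    ((λ_ (𝟙_ C)).hom ▷ (X ⊗ Y) ≫ (λ_ (X ⊗ Y)).hom)
  rw [id_tensorHom_id, tensorHom_id, tensorHom_id, tensorHom_id] at h
  rw [← tensorHom_comp_tensorHom, ← tensorHom_comp_tensorHom, leftUnitor_monoidal, h,
    comp_whiskerRight, Category.assoc, Category.assoc]

theorem comul_tensor_counit_right [BraidedCategory C] {X Y : C} (f : X ⟶ X ⊗ X) (g : Y ⟶ Y ⊗ Y)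
    (a : X ⟶ 𝟙_ C) (b : Y ⟶ 𝟙_ C) :
    ((f ⊗ₘ g) ≫ tensorμ X X Y Y) ≫ (X ⊗ Y) ◁ ((a ⊗ₘ b) ≫ (λ_ (𝟙_ C)).hom) ≫ (ρ_ (X ⊗ Y)).hom =
      (f ≫ X ◁ a ≫ (ρ_ X).hom) ⊗ₘ (g ≫ Y ◁ b ≫ (ρ_ Y).hom) := by
  have h := tensorμ_natural_assoc (𝟙 X) a (𝟙 Y) b
    ((X ⊗ Y) ◁ (λ_ (𝟙_ C)).hom ≫ (ρ_ (X ⊗ Y)).hom)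
  rw [id_tensorHom_id, id_tensorHom, id_tensorHom, id_tensorHom] at h
  rw [← tensorHom_comp_tensorHom, ← tensorHom_comp_tensorHom, rightUnitor_monoidal, h,
    MonoidalCategory.whiskerLeft_comp, Category.assoc, Category.assoc]

end Coherence

/-! ### The inverse of a braided equivalence. -/

section Equivalence

open Functor.LaxMonoidal Functor.OplaxMonoidal

variable {C D : Type*} [Category* C] [Category* D] [MonoidalCategory C] [MonoidalCategory D]
  [BraidedCategory C] [BraidedCategory D]

/-- The inverse of a braided equivalence is braided. -/
@[reducible]
def Equivalence.inverseBraided (e : C ≌ D) [e.functor.Braided] [e.inverse.Monoidal]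
    [e.IsMonoidal] : e.inverse.Braided where
  -- As `e.functor` is faithful and the counit invertible, it suffices to compare images followed by
  -- the counit. There the claim reduces to naturality of the counit and of the braiding, and to
  -- `e.functor` being braided.
  braided X Y := e.functor.map_injective <| by
    have h := e.counit.naturality (β_ X Y).hom
    dsimp only [Functor.comp_map, Functor.id_map, Functor.comp_obj, Functor.id_obj] at h
    rw [← cancel_mono (e.counit.app (Y ⊗ X)), Functor.map_comp, Functor.map_comp,
      Category.assoc, Category.assoc, h, e.functor_map_μ_inverse_comp_counit_app_tensor_assoc,
      e.functor_map_μ_inverse_comp_counit_app_tensor, Functor.map_braiding,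
      BraidedCategory.braiding_naturality, Category.assoc, Category.assoc,
      Functor.Monoidal.μ_δ_assoc]

theorem Equivalence.exists_braided_inverse (e : C ≌ D) [e.functor.Braided] :
    ∃ (G : D ⥤ C) (_ : G.Braided) (φ : 𝟭 C ≅ e.functor ⋙ G) (ψ : G ⋙ e.functor ≅ 𝟭 D),
      NatTrans.IsMonoidal φ.hom ∧ NatTrans.IsMonoidal ψ.hom := by
  let : e.inverse.Monoidal := e.inverseMonoidal
  have : e.IsMonoidal :=
    letI := e.toAdjunction.rightAdjointLaxMonoidal
    inferInstanceAs e.toAdjunction.IsMonoidal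
  let : e.inverse.Braided := e.inverseBraided
  exact ⟨e.inverse, inferInstance, e.unitIso, e.counitIso,
    inferInstanceAs (NatTrans.IsMonoidal e.unit), inferInstanceAs (NatTrans.IsMonoidal e.counit)⟩

end Equivalence

end CategoryTheory

namespace PathCalculus

open MonoidalCategory Diagram

/-! ### The generators as morphisms of `Path`. -/

namespace PathCat

variable {S : Type u} [Semiring S]

variable (S) in
/-- The generating object of `Path`. -/
def wire : PathCat S := ⟨1⟩

variable (S) in
/-- The comultiplication `δ` as a morphism of `Path`. -/
def copy : wire S ⟶ wire S ⊗ wire S := ofDiagram delta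

variable (S) in
/-- The counit `ε` as a morphism of `Path`. -/
def discard : wire S ⟶ 𝟙_ (PathCat S) := ofDiagram epsilon

variable (S) in
/-- The multiplication `μ` as a morphism of `Path`. -/
def add : wire S ⊗ wire S ⟶ wire S := ofDiagram mu

variable (S) in
/-- The unit `η` as a morphism of `Path`. -/
def zero : 𝟙_ (PathCat S) ⟶ wire S := ofDiagram eta

/-- The generator labelled by `r` as a morphism of `Path`. -/
def scale (r : S) : wire S ⟶ wire S := ofDiagram (scalar r)

/-- At numeral arities the associators and unitors reduce to identity diagrams, so the strict rule
becomes the coherent one by inserting an identity. The same device recurs below. -/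
theorem copy_assoc : copy S ≫ copy S ▷ wire S ≫ (α_ _ _ _).hom = copy S ≫ wire S ◁ copy S :=
  (congrArg (copy S ≫ ·) (Category.comp_id (copy S ▷ wire S))).trans
    (Quotient.sound Eqv.delta_assoc)

theorem copy_discard : copy S ≫ wire S ◁ discard S ≫ (ρ_ _).hom = 𝟙 _ :=
  (congrArg (copy S ≫ ·) (Category.comp_id (wire S ◁ discard S))).trans
    (Quotient.sound Eqv.delta_epsilon)

theorem discard_copy : copy S ≫ discard S ▷ wire S ≫ (λ_ _).hom = 𝟙 _ :=
  (congrArg (copy S ≫ ·) (Category.comp_id (discard S ▷ wire S))).trans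
    (Quotient.sound Eqv.epsilon_delta)

theorem copy_braiding : copy S ≫ (β_ _ _).hom = copy S := Quotient.sound Eqv.delta_comm

protected theorem add_assoc : add S ▷ wire S ≫ add S = (α_ _ _ _).hom ≫ wire S ◁ add S ≫ add S :=
  Eq.trans (Quotient.sound Eqv.mu_assoc)
    (Category.id_comp (wire S ◁ add S ≫ add S : wire S ⊗ wire S ⊗ wire S ⟶ wire S)).symm

protected theorem zero_add : zero S ▷ wire S ≫ add S = (λ_ _).hom := Quotient.sound Eqv.eta_mu

protected theorem add_zero : wire S ◁ zero S ≫ add S = (ρ_ _).hom := Quotient.sound Eqv.mu_eta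

theorem braiding_add : (β_ _ _).hom ≫ add S = add S := Quotient.sound Eqv.mu_comm

/-- This is the `delta` case of `copyAll_natural`: copying commutes with itself. Coassociativity
makes the two middle outputs come from a single `copy`, and cocommutativity absorbs their crossing.
-/
theorem copy_tensor_copy :
    copy S ≫ (copy S ⊗ₘ copy S) ≫ tensorμ _ _ _ _ = copy S ≫ (copy S ⊗ₘ copy S) := by
  have h₁ : copy S ≫ wire S ◁ copy S ≫ (α_ _ _ _).inv = copy S ≫ copy S ▷ wire S := by
    simp [← reassoc_of% (copy_assoc (S := S))]
  have h₂ : copy S ≫ (copy S ⊗ₘ copy S) ≫ (α_ _ _ _).hom ≫ wire S ◁ (α_ _ _ _).inv =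
      copy S ≫ wire S ◁ (copy S ≫ copy S ▷ wire S) := by
    rw [← h₁, MonoidalCategory.tensorHom_def, Category.assoc, associator_naturality_right_assoc,
      reassoc_of% (copy_assoc (S := S))]
    simp only [MonoidalCategory.whiskerLeft_comp]
  rw [tensorμ, reassoc_of% h₂, ← MonoidalCategory.whiskerLeft_comp_assoc, Category.assoc,
    ← comp_whiskerRight, copy_braiding, ← reassoc_of% h₂]
  simp

/-! ### Copying and discarding bundles of wires. -/

variable (S) in
/-- The unique morphism to the tensor unit, which discards all wires. -/
def discardAll : ∀ n : ℕ, (⟨n⟩ : PathCat S) ⟶ 𝟙_ (PathCat S)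
  | 0 => 𝟙 (𝟙_ (PathCat S))
  | n + 1 => (discardAll n ⊗ₘ discard S) ≫ (λ_ (𝟙_ (PathCat S))).hom

variable (S) in
/-- The diagonal of an object, which copies all wires. -/
def copyAll : ∀ n : ℕ, (⟨n⟩ : PathCat S) ⟶ (⟨n⟩ : PathCat S) ⊗ (⟨n⟩ : PathCat S)
  | 0 => (λ_ (𝟙_ (PathCat S))).inv
  | n + 1 => (copyAll n ⊗ₘ copy S) ≫ tensorμ _ _ (wire S) (wire S)

/-- True by `rfl` because the recursion adds the new wire on the right, where `X.arity + 1` is a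
successor. For the same reason the inductions below run on the right factor, and their associators
are identities. -/
theorem discardAll_succ (X : PathCat S) : discardAll S (X ⊗ wire S).arity =
    (discardAll S X.arity ⊗ₘ discard S) ≫ (λ_ (𝟙_ (PathCat S))).hom := rfl

theorem discardAll_one : discardAll S 1 = discard S := by
  have h : discardAll S 1 =
      (λ_ (wire S)).hom ≫ discard S := by
    refine (discardAll_succ (𝟙_ (PathCat S))).trans ?_
    rw [← leftUnitor_naturality, ← id_tensorHom]
    rfl
  rw [h]
  exact Category.id_comp _

theorem discardAll_add (X : PathCat S) : ∀ n : ℕ,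
    discardAll S (X ⊗ (⟨n⟩ : PathCat S)).arity =
      (discardAll S X.arity ⊗ₘ discardAll S n) ≫ (λ_ (𝟙_ (PathCat S))).hom
  | 0 => by
    have h : (discardAll S X.arity ⊗ₘ 𝟙 (𝟙_ (PathCat S))) ≫ (λ_ (𝟙_ (PathCat S))).hom =
        (ρ_ X).hom ≫ discardAll S X.arity := by
      rw [unitors_equal, tensorHom_id, rightUnitor_naturality]
    exact (h.trans (Category.id_comp _)).symm
  | n + 1 => by
    have h := tensorHom_leftUnitor_assoc (discardAll S X.arity) (discardAll S n) (discard S)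
    rw [← discardAll_add X n] at h
    exact h.symm.trans (Category.id_comp _)

theorem copyAll_one : copyAll S 1 = copy S := by
  have h : ((λ_ (𝟙_ (PathCat S))).inv ⊗ₘ copy S) ≫ tensorμ _ _ (wire S) (wire S) ≫
      ((λ_ (wire S)).hom ⊗ₘ (λ_ (wire S)).hom) = (λ_ (wire S)).hom ≫ copy S := by
    rw [tensorHom_def', Category.assoc, ← tensor_left_unitality, leftUnitor_naturality]
  rw [← Category.assoc] at h
  exact ((Category.comp_id _).symm.trans (congrArg (copyAll S 1 ≫ ·)
    (id_tensorHom_id (wire S) (wire S)).symm)).trans (h.trans (Category.id_comp (copy S)))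

theorem copyAll_add (X : PathCat S) : ∀ n : ℕ,
    copyAll S (X ⊗ (⟨n⟩ : PathCat S)).arity =
      (copyAll S X.arity ⊗ₘ copyAll S n) ≫ tensorμ _ _ (⟨n⟩ : PathCat S) (⟨n⟩ : PathCat S)
  | 0 => by
    have h : (copyAll S X.arity ⊗ₘ (λ_ (𝟙_ (PathCat S))).inv) ≫
        tensorμ X X (𝟙_ (PathCat S)) (𝟙_ (PathCat S)) ≫ ((ρ_ X).hom ⊗ₘ (ρ_ X).hom) =
        (ρ_ X).hom ≫ copyAll S X.arity := by
      rw [MonoidalCategory.tensorHom_def, Category.assoc, ← tensor_right_unitality,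
        rightUnitor_naturality]
    rw [← Category.assoc] at h
    exact ((Category.id_comp _).symm.trans h.symm).trans
      ((congrArg (_ ≫ ·) (id_tensorHom_id X X)).trans (Category.comp_id _))
  | n + 1 => by
    have h := tensorHom_tensorμ_assoc (copyAll S X.arity) (copyAll S n) (copy S)
    rw [← copyAll_add X n] at h
    exact ((Category.comp_id _).symm.trans (congrArg (_ ≫ ·)
      (id_tensorHom_id (X ⊗ (⟨n⟩ : PathCat S) ⊗ wire S)
        (X ⊗ (⟨n⟩ : PathCat S) ⊗ wire S)).symm)).trans
      (h.trans (Category.id_comp _))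

/-- The morphism of `Path` represented by a diagram, between the objects with given arities. -/
def ofArity {m n : ℕ} (f : Diagram S m n) : (⟨m⟩ : PathCat S) ⟶ ⟨n⟩ := ofDiagram f

theorem ofArity_comp {m n k : ℕ} (f : Diagram S m n) (g : Diagram S n k) :
    ofArity (f.comp g) = ofArity f ≫ ofArity g := rfl

theorem ofArity_tensor {m n p q : ℕ} (f : Diagram S m n) (g : Diagram S p q) :
    ofArity (f.tensor g) = ofArity f ⊗ₘ ofArity g := rfl

theorem discardAll_two :
    discardAll S 2 = (discard S ⊗ₘ discard S) ≫ (λ_ (𝟙_ (PathCat S))).hom := by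
  rw [← discardAll_one]
  exact discardAll_add (wire S) 1

theorem copyAll_two : copyAll S 2 = (copy S ⊗ₘ copy S) ≫ tensorμ _ _ _ _ := by
  rw [← copyAll_one]
  exact copyAll_add (wire S) 1

/-- Removes the associators from `tensorμ`, giving the middle crossing in the form used by the rule
`Eqv.mu_delta`. -/
theorem tensorμ_wire : tensorμ (wire S) (wire S) (wire S) (wire S) =
    (wire S ◁ (β_ (wire S) (wire S)).hom) ▷ wire S := by
  have h : (wire S ◁ (β_ (wire S) (wire S)).hom) ▷ wire S =
      wire S ◁ ((β_ (wire S) (wire S)).hom ▷ wire S) :=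
    (whisker_assoc (wire S) (β_ (wire S) (wire S)).hom (wire S)).trans
      ((Category.id_comp _).trans (Category.comp_id _))
  refine Eq.trans ?_ h.symm
  have h' : wire S ◁ (α_ (wire S) (wire S) (wire S)).inv = 𝟙 _ :=
    MonoidalCategory.whiskerLeft_id (wire S) (wire S ⊗ wire S ⊗ wire S)
  have h'' : wire S ◁ (α_ (wire S) (wire S) (wire S)).hom = 𝟙 _ :=
    MonoidalCategory.whiskerLeft_id (wire S) (wire S ⊗ wire S ⊗ wire S)
  rw [tensorμ, h', h'']
  refine (Category.id_comp _).trans ((Category.id_comp _).trans ?_)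
  refine (congrArg (_ ≫ ·) (Category.id_comp _)).trans (Category.comp_id _)

theorem discardAll_natural {m n : ℕ} (f : Diagram S m n) :
    ofArity f ≫ discardAll S n = discardAll S m := by
  induction f with
  | id n => exact Category.id_comp _
  | comp f g hf hg => rw [ofArity_comp, Category.assoc, hg, hf]
  | @tensor m n p q f g hf hg =>
    have h := tensorHom_comp_tensorHom_assoc (ofArity f) (ofArity g) (discardAll S n)
      (discardAll S q) (λ_ (𝟙_ (PathCat S))).hom
    rw [hf, hg, ← discardAll_add ⟨m⟩, ← discardAll_add ⟨n⟩] at h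
    exact h
  | swap m n =>
    have h := tensorHom_leftUnitor_braiding (discardAll S m) (discardAll S n)
    rw [← discardAll_add ⟨m⟩, ← discardAll_add ⟨n⟩] at h
    exact h
  | delta =>
    have h : copy S ≫ (discard S ⊗ₘ discard S) ≫ (λ_ (𝟙_ (PathCat S))).hom = discard S := by
      rw [MonoidalCategory.tensorHom_def, Category.assoc, leftUnitor_naturality,
        reassoc_of% (discard_copy (S := S))]
    exact (congrArg (copy S ≫ ·) discardAll_two).trans (h.trans discardAll_one.symm)
  | epsilon => exact (Category.comp_id _).trans discardAll_one.symm
  | mu =>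
    have h : add S ≫ discard S = (discard S ⊗ₘ discard S) ≫ (λ_ (𝟙_ (PathCat S))).hom :=
      Eq.trans (Quotient.sound Eqv.mu_epsilon) (Category.comp_id (discard S ⊗ₘ discard S)).symm
    exact (congrArg (add S ≫ ·) discardAll_one).trans (h.trans discardAll_two.symm)
  | eta => exact (congrArg (zero S ≫ ·) discardAll_one).trans (Quotient.sound Eqv.eta_epsilon)
  | scalar r =>
    exact (congrArg (scale r ≫ ·) discardAll_one).trans
      (Eq.trans (Quotient.sound (Eqv.scalar_epsilon r)) discardAll_one.symm)

/-- The structural cases are formal. Among the generators, `mu` and `eta` use the bialgebra laws,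
`scalar` the compatibility with `δ`, `epsilon` the counit law and `delta` the lemma
`copy_tensor_copy`. -/
theorem copyAll_natural {m n : ℕ} (f : Diagram S m n) :
    ofArity f ≫ copyAll S n = copyAll S m ≫ (ofArity f ⊗ₘ ofArity f) := by
  induction f with
  | id n =>
    exact (Category.id_comp _).trans ((Category.comp_id _).symm.trans
      (congrArg (copyAll S n ≫ ·) (id_tensorHom_id (⟨n⟩ : PathCat S) ⟨n⟩).symm))
  | comp f g hf hg =>
    rw [ofArity_comp, Category.assoc, hg, reassoc_of% hf, tensorHom_comp_tensorHom]
  | @tensor m n p q f g hf hg =>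
    have h : (ofArity f ⊗ₘ ofArity g) ≫ (copyAll S n ⊗ₘ copyAll S q) ≫ tensorμ _ _ _ _ =
        ((copyAll S m ⊗ₘ copyAll S p) ≫ tensorμ _ _ _ _) ≫
          ((ofArity f ⊗ₘ ofArity g) ⊗ₘ (ofArity f ⊗ₘ ofArity g)) := by
      rw [tensorHom_comp_tensorHom_assoc, hf, hg, ← tensorHom_comp_tensorHom_assoc,
        tensorμ_natural, Category.assoc]
    rw [← copyAll_add ⟨m⟩, ← copyAll_add ⟨n⟩] at h
    exact h
  | swap m n =>
    have h : (β_ (⟨m⟩ : PathCat S) ⟨n⟩).hom ≫ (copyAll S n ⊗ₘ copyAll S m) ≫ tensorμ _ _ _ _ =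
        ((copyAll S m ⊗ₘ copyAll S n) ≫ tensorμ _ _ _ _) ≫
          ((β_ (⟨m⟩ : PathCat S) ⟨n⟩).hom ⊗ₘ (β_ (⟨m⟩ : PathCat S) ⟨n⟩).hom) := by
      rw [Category.assoc, tensorμ_braiding, BraidedCategory.braiding_naturality_assoc]
    rw [← copyAll_add ⟨m⟩, ← copyAll_add ⟨n⟩] at h
    exact h
  | delta =>
    have h := copy_tensor_copy (S := S)
    rw [← copyAll_two] at h
    exact h.trans (congrArg (· ≫ (copy S ⊗ₘ copy S)) copyAll_one.symm)
  | epsilon =>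
    have h : discard S ≫ (λ_ (𝟙_ (PathCat S))).inv = copy S ≫ (discard S ⊗ₘ discard S) := by
      rw [Iso.comp_inv_eq, MonoidalCategory.tensorHom_def, Category.assoc, Category.assoc,
        leftUnitor_naturality, reassoc_of% (discard_copy (S := S))]
    exact h.trans (congrArg (· ≫ (discard S ⊗ₘ discard S)) copyAll_one.symm)
  | mu =>
    have h : add S ≫ copy S = (copy S ⊗ₘ copy S) ≫ tensorμ _ _ _ _ ≫ (add S ⊗ₘ add S) := by
      rw [tensorμ_wire]
      exact Quotient.sound Eqv.mu_delta
    rw [← Category.assoc, ← copyAll_two] at h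
    exact (congrArg (add S ≫ ·) copyAll_one).trans h
  | eta =>
    have h : zero S ≫ copy S = (λ_ (𝟙_ (PathCat S))).inv ≫ (zero S ⊗ₘ zero S) :=
      Eq.trans (Quotient.sound Eqv.eta_delta) (Category.id_comp (zero S ⊗ₘ zero S)).symm
    exact (congrArg (zero S ≫ ·) copyAll_one).trans h
  | scalar r =>
    have h : scale r ≫ copy S = copy S ≫ (scale r ⊗ₘ scale r) :=
      Quotient.sound (Eqv.scalar_delta r)
    rw [← copyAll_one] at h
    exact h

theorem copyAll_discardAll_left : ∀ n : ℕ, copyAll S n ≫ discardAll S n ▷ (⟨n⟩ : PathCat S) ≫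
    (λ_ (⟨n⟩ : PathCat S)).hom = 𝟙 (⟨n⟩ : PathCat S)
  | 0 => by
    have h : (λ_ (𝟙_ (PathCat S))).inv ≫ 𝟙 (𝟙_ (PathCat S)) ▷ _ ≫ (λ_ _).hom = 𝟙 _ := by simp
    exact h
  | n + 1 => by
    have h := comul_tensor_counit_left (copyAll S n) (copy S) (discardAll S n) (discard S)
    rw [copyAll_discardAll_left n, discard_copy, id_tensorHom_id] at h
    exact h

theorem copyAll_discardAll_right : ∀ n : ℕ, copyAll S n ≫ (⟨n⟩ : PathCat S) ◁ discardAll S n ≫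
    (ρ_ (⟨n⟩ : PathCat S)).hom = 𝟙 (⟨n⟩ : PathCat S)
  | 0 => by
    have h : (λ_ (𝟙_ (PathCat S))).inv ≫ _ ◁ 𝟙 (𝟙_ (PathCat S)) ≫ (ρ_ _).hom = 𝟙 _ := by
      simp [← unitors_equal]
    exact h
  | n + 1 => by
    have h := comul_tensor_counit_right (copyAll S n) (copy S) (discardAll S n) (discard S)
    rw [copyAll_discardAll_right n, copy_discard, id_tensorHom_id] at h
    exact h

instance : CartesianMonoidalCategory (PathCat S) :=
  .ofNaturalComul (fun X => discardAll S X.arity) (fun X => copyAll S X.arity)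
    (by rintro X Y ⟨f⟩; exact discardAll_natural f) (by rintro X Y ⟨f⟩; exact copyAll_natural f)
    rfl (fun X Y => copyAll_add X Y.arity) (fun X => copyAll_discardAll_left X.arity)
    (fun X => copyAll_discardAll_right X.arity)

/-! ### Addition of morphisms into a wire, and the action of scalars. -/

open CartesianMonoidalCategory

instance : AddMonObj (wire S) where
  zero := zero S
  add := add S
  zero_add := PathCat.zero_add
  add_zero := PathCat.add_zero
  add_assoc := PathCat.add_assoc

instance : IsCommAddMonObj (wire S) where
  add_comm := braiding_add

open scoped AddMonObj MonObj

/-- Precomposition is additive for any morphism into a monoid object; postcomposition needs the rule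
that `r` is a monoid endomorphism. -/
theorem add_comp_scale {X : PathCat S} (f g : X ⟶ wire S) (r : S) :
    (f + g) ≫ scale r = f ≫ scale r + g ≫ scale r := by
  have h : add S ≫ scale r = (scale r ⊗ₘ scale r) ≫ add S := Quotient.sound (Eqv.mu_scalar r)
  rw [Hom.add_def, Hom.add_def, ← lift_map_assoc, Category.assoc]
  exact congrArg (lift f g ≫ ·) h

theorem zero_comp_scale {X : PathCat S} (r : S) : (0 : X ⟶ wire S) ≫ scale r = 0 := by
  have h : zero S ≫ scale r = zero S := Quotient.sound (Eqv.eta_scalar r)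
  rw [Hom.zero_def, Category.assoc]
  exact congrArg (toUnit X ≫ ·) h

theorem scale_zero : scale (0 : S) = 0 := by
  rw [Hom.zero_def, toUnit_unique (toUnit _) (discard S)]
  exact Quotient.sound Eqv.scalar_zero

theorem scale_one : scale (1 : S) = 𝟙 (wire S) := Quotient.sound Eqv.scalar_one

theorem scale_comp_scale (r s : S) : scale r ≫ scale s = scale (r * s) :=
  Quotient.sound (Eqv.scalar_mul r s)

theorem copy_fst : copy S ≫ fst _ _ = 𝟙 (wire S) :=
  (congrArg (copy S ≫ wire S ◁ · ≫ (ρ_ _).hom) discardAll_one).trans copy_discard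

theorem copy_snd : copy S ≫ snd _ _ = 𝟙 (wire S) :=
  (congrArg (copy S ≫ · ▷ wire S ≫ (λ_ _).hom) discardAll_one).trans discard_copy

theorem copy_eq_lift : copy S = lift (𝟙 (wire S)) (𝟙 (wire S)) := by
  ext
  · rw [copy_fst, lift_fst]
  · rw [copy_snd, lift_snd]

/-- Since `copy` is the diagonal, `δ;(r ⊗ s);μ` is the sum in the hom-monoid. -/
theorem scale_add (r s : S) : scale (r + s) = scale r + scale s := by
  have h : copy S ≫ (scale r ⊗ₘ scale s) ≫ add S = scale (r + s) :=
    Quotient.sound (Eqv.scalar_add r s)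
  rw [← h, copy_eq_lift, lift_map_assoc, Category.id_comp, Category.id_comp]
  rfl

theorem comp_sum {J : Type*} (s : Finset J) {X Y : PathCat S} (h : X ⟶ Y) (f : J → (Y ⟶ wire S)) :
    h ≫ ∑ i ∈ s, f i = ∑ i ∈ s, h ≫ f i :=
  map_sum (⟨⟨(h ≫ ·), AddMonObj.comp_zero h⟩, AddMonObj.comp_add h⟩ :
    (Y ⟶ wire S) →+ (X ⟶ wire S)) f s

theorem sum_comp_scale {J : Type*} (s : Finset J) {X : PathCat S} (f : J → (X ⟶ wire S)) (r : S) :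
    (∑ i ∈ s, f i) ≫ scale r = ∑ i ∈ s, f i ≫ scale r :=
  map_sum (⟨⟨(· ≫ scale r), zero_comp_scale r⟩, fun f g => add_comp_scale f g r⟩ :
    (X ⟶ wire S) →+ (X ⟶ wire S)) f s

theorem scale_sum {J : Type*} (s : Finset J) (f : J → S) :
    scale (∑ i ∈ s, f i) = ∑ i ∈ s, scale (f i) :=
  map_sum (⟨⟨scale, scale_zero⟩, scale_add⟩ : S →+ (wire S ⟶ wire S)) f s

/-! ### The object `n` as the `n`-fold power of a wire. -/

/-- The projection of `n` wires to the wire with a given index. -/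
def proj : ∀ {n : ℕ}, Fin n → ((⟨n⟩ : PathCat S) ⟶ wire S)
  | 0, i => i.elim0
  | n + 1, i => Fin.lastCases (motive := fun _ => (⟨n⟩ : PathCat S) ⊗ wire S ⟶ wire S)
      (snd (⟨n⟩ : PathCat S) (wire S)) (fun j => fst (⟨n⟩ : PathCat S) (wire S) ≫ proj j) i

theorem proj_last (n : ℕ) : proj (Fin.last n) = snd (⟨n⟩ : PathCat S) (wire S) :=
  Fin.lastCases_last

theorem proj_castSucc {n : ℕ} (i : Fin n) :
    proj i.castSucc = fst (⟨n⟩ : PathCat S) (wire S) ≫ proj i :=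
  Fin.lastCases_castSucc ..

theorem proj_zero : proj (0 : Fin 1) = 𝟙 (wire S) := by
  refine (proj_last 0).trans ?_
  exact (leftUnitor_hom (wire S)).symm

theorem hom_ext {X : PathCat S} : ∀ {n : ℕ} {f g : X ⟶ (⟨n⟩ : PathCat S)},
    (∀ i, f ≫ proj i = g ≫ proj i) → f = g
  | 0, f, g, _ => toUnit_unique (C := PathCat S) f g
  | n + 1, f, g, h => CartesianMonoidalCategory.hom_ext (X := (⟨n⟩ : PathCat S)) (Y := wire S) f g
      (hom_ext fun i => by
        have h' := h i.castSucc
        rw [proj_castSucc] at h'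
        exact (Category.assoc ..).trans (h'.trans (Category.assoc ..).symm))
      (by simpa only [proj_last] using! h (Fin.last n))

theorem exists_comp_proj {X : PathCat S} : ∀ {n : ℕ} (v : Fin n → (X ⟶ wire S)),
    ∃ f : X ⟶ (⟨n⟩ : PathCat S), ∀ i, f ≫ proj i = v i
  | 0, v => ⟨toUnit X, fun i => i.elim0⟩
  | n + 1, v => by
    obtain ⟨f, hf⟩ := exists_comp_proj fun i => v i.castSucc
    refine ⟨lift f (v (Fin.last n)), fun i => ?_⟩
    induction i using Fin.lastCases with
    | last => rw [proj_last]; exact lift_snd ..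
    | cast i => rw [proj_castSucc]; exact (lift_fst_assoc ..).trans (hf i)

theorem proj_castAdd (X : PathCat S) (i : Fin X.arity) : ∀ n : ℕ,
    proj (Fin.castAdd n i) = fst X (⟨n⟩ : PathCat S) ≫ proj i
  | 0 => by
    have h : fst X (𝟙_ (PathCat S)) = 𝟙 X := (rightUnitor_hom X).symm
    refine Eq.trans ?_ (congrArg (· ≫ proj i) h.symm)
    exact (Category.id_comp _).symm
  | n + 1 => by
    refine (proj_castSucc (Fin.castAdd n i)).trans ?_
    rw [proj_castAdd X i n]
    have h := associator_hom_fst_assoc X (⟨n⟩ : PathCat S) (wire S) (proj i)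
    exact h.symm.trans (Category.id_comp _)

theorem proj_natAdd (X : PathCat S) : ∀ {n : ℕ} (i : Fin n),
    proj (Fin.natAdd X.arity i) = snd X (⟨n⟩ : PathCat S) ≫ proj i
  | n + 1, i => by
    induction i using Fin.lastCases with
    | last =>
      rw [proj_last]
      refine (proj_last (X.arity + n)).trans ?_
      have h := associator_hom_snd_snd X (⟨n⟩ : PathCat S) (wire S)
      exact h.symm.trans (Category.id_comp _)
    | cast i =>
      rw [proj_castSucc]
      refine (proj_castSucc (Fin.natAdd X.arity i)).trans ?_
      rw [proj_natAdd X i]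
      have h := associator_hom_snd_fst_assoc X (⟨n⟩ : PathCat S) (wire S) (proj i)
      exact h.symm.trans (Category.id_comp _)

theorem proj_two_zero : proj (0 : Fin 2) = fst (wire S) (wire S) := by
  have h : fst (wire S) (wire S) ≫ 𝟙 (wire S) = fst (wire S) (wire S) := Category.comp_id _
  rw [← proj_zero] at h
  exact (proj_castSucc (0 : Fin 1)).trans h

theorem proj_two_one : proj (1 : Fin 2) = snd (wire S) (wire S) := proj_last 1

/-! ### Diagrams as linear combinations of projections. -/

theorem sum_proj_permMatrix {m n : ℕ} (e : Fin m ≃ Fin n) (j : Fin n) :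
    ∑ i, proj i ≫ scale (permMatrix S e i j) = proj (e.symm j) := by
  rw [Finset.sum_eq_single (e.symm j)]
  · simp [permMatrix, scale_one]
  · intro i _ h
    rw [permMatrix, if_neg (mt e.eq_symm_apply.2 h), scale_zero, AddMonObj.comp_zero]
  · simp

/-- The normal form: the right-hand side depends on `f` only through its matrix. -/
theorem ofArity_comp_proj {m n : ℕ} (f : Diagram S m n) (j : Fin n) :
    ofArity f ≫ proj j = ∑ i, proj i ≫ scale (f.toMatrix i j) := by
  induction f with
  | id n =>
    rw [toMatrix, ← permMatrix_refl, sum_proj_permMatrix]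
    exact Category.id_comp _
  | comp f g hf hg =>
    rw [ofArity_comp, Category.assoc, hg, comp_sum]
    simp only [← Category.assoc, hf, sum_comp_scale]
    -- With the sum over intermediate wires innermost, it collapses into one scalar, the entry of
    -- the matrix product; the factors keep their order, so `S` may be noncommutative.
    rw [Finset.sum_comm]
    simp only [Category.assoc, scale_comp_scale, ← comp_sum, ← scale_sum]
    rfl
  | @tensor m n p q f g hf hg =>
    rw [ofArity_tensor, Fin.sum_univ_add]
    simp only [toMatrix, directSum_apply]
    induction j using Fin.addCases with
    | left j =>
      have h := hf j
      rw [proj_castAdd (⟨n⟩ : PathCat S)]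
      refine (tensorHom_fst_assoc ..).trans ?_
      rw [hf, comp_sum]
      simp only [proj_castAdd (⟨m⟩ : PathCat S), Category.assoc]
      simp [scale_zero, AddMonObj.comp_zero]
    | right j =>
      rw [proj_natAdd (⟨n⟩ : PathCat S)]
      refine (tensorHom_snd_assoc ..).trans ?_
      rw [hg, comp_sum]
      simp only [proj_natAdd (⟨m⟩ : PathCat S), Category.assoc]
      simp [scale_zero, AddMonObj.comp_zero]
  | swap m n =>
    rw [toMatrix, swapMatrix, sum_proj_permMatrix]
    induction j using Fin.addCases with
    | left j =>
      rw [proj_castAdd (⟨n⟩ : PathCat S)]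
      refine (braiding_hom_fst_assoc ..).trans ((proj_natAdd (⟨m⟩ : PathCat S) j).symm.trans ?_)
      congr 1
      exact (finAddFlip_apply_castAdd j m).symm
    | right j =>
      rw [proj_natAdd (⟨n⟩ : PathCat S)]
      refine (braiding_hom_snd_assoc ..).trans ((proj_castAdd (⟨m⟩ : PathCat S) j n).symm.trans ?_)
      congr 1
      exact (finAddFlip_apply_natAdd j n).symm
  | delta =>
    rw [Fin.sum_univ_one, proj_zero]
    fin_cases j
    · refine (congrArg (copy S ≫ ·) proj_two_zero).trans (copy_fst.trans ?_)
      simp [toMatrix, scale_one]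
      exact (Category.comp_id _).symm
    · refine (congrArg (copy S ≫ ·) proj_two_one).trans (copy_snd.trans ?_)
      simp [toMatrix, scale_one]
      exact (Category.comp_id _).symm
  | epsilon => exact j.elim0
  | mu =>
    rw [Fin.sum_univ_two, (Subsingleton.elim j 0 : j = (0 : Fin 1)), proj_zero, proj_two_zero,
      proj_two_one]
    simp only [toMatrix, Matrix.of_apply, Matrix.cons_val_zero, Matrix.cons_val_one, scale_one]
    have h : add S ≫ 𝟙 (wire S) = fst _ _ ≫ 𝟙 _ + snd _ _ ≫ 𝟙 _ := by
      rw [Category.comp_id, Category.comp_id, Category.comp_id, Hom.add_def, lift_fst_snd,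
        Category.id_comp]
      rfl
    exact h
  | eta =>
    rw [Finset.univ_eq_empty, Finset.sum_empty, Hom.zero_def,
      (Subsingleton.elim j 0 : j = (0 : Fin 1)), proj_zero]
    have h : zero S ≫ 𝟙 (wire S) = toUnit (𝟙_ (PathCat S)) ≫ zero S := by
      rw [Category.comp_id, toUnit_unit, Category.id_comp]
    exact h
  | scalar r =>
    rw [Fin.sum_univ_one, (Subsingleton.elim j 0 : j = (0 : Fin 1)), proj_zero]
    exact (Category.comp_id _).trans (Category.id_comp _).symm

/-! ### Completeness and realisation of all matrices. -/

theorem scale_injective : Function.Injective (scale : S → (wire S ⟶ wire S)) := fun _ _ h =>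
  congrFun (congrFun (Eqv.toMatrix_eq (Quotient.exact h)) (0 : Fin 1)) (0 : Fin 1)

theorem eqv_of_toMatrix_eq {m n : ℕ} {f g : Diagram S m n} (h : f.toMatrix = g.toMatrix) :
    f.Eqv g := by
  have h' : ofArity f = ofArity g := hom_ext fun j => by
    rw [ofArity_comp_proj, ofArity_comp_proj, h]
  exact Quotient.exact h'

theorem toMatrix_surjective {m n : ℕ} (A : Matrix (Fin m) (Fin n) S) :
    ∃ f : Diagram S m n, f.toMatrix = A := by
  obtain ⟨⟨f⟩, hf⟩ := exists_comp_proj fun j => ∑ i, proj i ≫ scale (A i j)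
  refine ⟨f, ?_⟩
  ext i j
  -- `v` feeds one wire into input `i` and zero into the others; precomposing with it extracts row
  -- `i` of a matrix as scalars, which `scale_injective` then compares.
  obtain ⟨v, hv⟩ := exists_comp_proj fun k => scale ((1 : Matrix (Fin m) (Fin m) S) i k)
  have h : ∀ B : Matrix (Fin m) (Fin n) S, v ≫ ∑ k, proj k ≫ scale (B k j) = scale (B i j) := by
    intro B
    simp only [comp_sum, ← Category.assoc, hv, scale_comp_scale, ← scale_sum]
    rw [← Matrix.mul_apply, Matrix.one_mul]
  apply scale_injective
  rw [← h A, ← h f.toMatrix, ← ofArity_comp_proj, ← hf]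
  rfl

end PathCat

/-! ### The interpretation is an equivalence. -/

section PathCategory

variable (S : Type u) [Semiring S]

instance : (interpretation S).Faithful where
  map_injective := by
    rintro X Y ⟨f⟩ ⟨g⟩ h
    exact Quotient.sound (PathCat.eqv_of_toMatrix_eq (congrArg MatCat.Hom.mat h))

instance : (interpretation S).Full where
  map_surjective A := by
    obtain ⟨f, hf⟩ := PathCat.toMatrix_surjective A.mat
    exact ⟨PathCat.ofDiagram f, MatCat.Hom.ext hf⟩

instance : (interpretation S).EssSurj where
  mem_essImage Y := ⟨⟨Y.dim⟩, ⟨Iso.refl Y⟩⟩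

instance : (interpretation S).IsEquivalence where

end PathCategory

end PathCalculus

theorem mainTheorem3 (S : Type u) [Semiring S] :
    (∀ (m n : ℕ) (f g : PathCalculus.Diagram S m n), f.Eqv g ↔ f.toMatrix = g.toMatrix) ∧
    ∃ (G : PathCalculus.MatCat S ⥤ PathCalculus.PathCat S) (_ : G.Braided)
      (φ : 𝟭 (PathCalculus.PathCat S) ≅ PathCalculus.interpretation S ⋙ G)
      (ψ : G ⋙ PathCalculus.interpretation S ≅ 𝟭 (PathCalculus.MatCat S)),
      NatTrans.IsMonoidal φ.hom ∧ NatTrans.IsMonoidal ψ.hom := by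
  refine ⟨fun m n f g => ⟨PathCalculus.Diagram.Eqv.toMatrix_eq,
    PathCalculus.PathCat.eqv_of_toMatrix_eq⟩, ?_⟩
  exact @Equivalence.exists_braided_inverse _ _ _ _ _ _ _ _
    (PathCalculus.interpretation S).asEquivalence
    (inferInstanceAs (PathCalculus.interpretation S).Braided)
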